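/- **Setting (random worlds).** Fix a finite first-order vocabulary of predicate, function and constant symbols. Formulas are built from atomic formulas (including equality) and comparisons $\zeta\approx_i\zeta'$, $\zeta\preceq_i\zeta'$ ($i\in\mathbb N$) of proportion expressions by negation, conjunction and universal quantification ($\varphi\Rightarrow\psi$ abbreviates $\neg(\varphi\wedge\neg\psi)$, i.e. $\neg\varphi\vee\psi$). Proportion expressions are built from numerical constants and conditional proportions $\lVert\psi\mid\varphi\rVert_X$ ($X$ a finite set of variables) by addition and multiplication; $\lVert\psi\rVert_X$ abbreviates $\lVert\psi\mid \mathrm{true}\rVert_X$. A world of size $N\ge 1$ is a structure with domain $\{1,\dots,N\}$; a tolerance vector is $\vec\tau=(\tau_i)_{i\in\mathbb N}$ with all $\tau_i>0$. In a world, $\lVert\psi\mid\varphi\rVert_X$ is the fraction of those $X$-tuples satisfying $\varphi$ that also satisfy $\psi$ (undefined if no tuple satisfies $\varphi$); $\zeta\approx_i\zeta'$ means $|\zeta-\zeta'|\le\tau_i$ and $\zeta\preceq_i\zeta'$ means $\zeta\le\zeta'+\tau_i$, a comparison with an undefined side being true. $\mathrm{KB}[\vec\tau]$ is the sentence $\mathrm{KB}$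 read with tolerances $\vec\tau$. $\mathrm{KB}\models\varphi$ means that for every $\vec\tau$, every world of any finite size $N\ge1$ satisfying $\mathrm{KB}[\vec\tau]$ satisfies $\varphi$ at tolerance $\vec\tau$, under every valuation of the free variables of $\varphi$. $\Pr_N^{\vec\tau}(\varphi\mid\mathrm{KB})$ is the fraction of the worlds of size $N$ satisfying $\mathrm{KB}[\vec\tau]$ in which $\varphi$ is true. The degree of belief $\Pr_\infty(\varphi\mid\mathrm{KB})$ exists and equals $p$ if $\mathrm{KB}$ is eventually consistent (for all sufficiently small $\vec\tau$ and all sufficiently large $N$, some world of size $N$ satisfies $\mathrm{KB}[\vec\tau]$) and $\lim_{\vec\tau\to0}\liminf_{N\to\infty}\Pr_N^{\vec\tau}(\varphi\mid\mathrm{KB})$ and $\lim_{\vec\tau\to0}\limsup_{N\to\infty}\Pr_N^{\vec\tau}(\varphi\mid\mathrm{KB})$ both exist and equal $p$. **Lemma.** Let $\mathrm{KB}$ be a sentence, $c$ a constant symbol, $\varphi_0(x),\theta(x),\xi(x)$ formulas with no free variable other than $x$, and $a,b\in\mathbb R$. Suppose: 1. $\mathrm{KB}\models\varphi_0(c)$;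 2. $\mathrm{KB}\models\forall x(\xi(x)\Rightarrow\theta(x))$; 3. for every expression $\lVert\theta(x)\mid\varphi(x)\rVert_x$ occurring in $\mathrm{KB}$, $\mathrm{KB}\models\forall x(\varphi_0(x)\Rightarrow\varphi(x))$ or $\mathrm{KB}\models\forall x(\varphi_0(x)\Rightarrow\neg\varphi(x))$; 4. for every expression $\lVert\xi(x)\mid\theta(x)\wedge\psi(x)\rVert_x$ occurring in $\mathrm{KB}$, $\mathrm{KB}\models\forall x(\varphi_0(x)\Rightarrow\psi(x))$ or $\mathrm{KB}\models\forall x(\varphi_0(x)\Rightarrow\neg\psi(x))$; 5. the (predicate, function and constant) symbols of $\theta$ and $\xi$ occur in $\mathrm{KB}$ only in subformulas $\forall x(\xi(x)\Rightarrow\theta(x))$, in the part $\theta(x)$ of expressions $\lVert\theta(x)\mid\varphi(x)\rVert_x$, and in the parts $\xi(x)$ and $\theta(x)$ of expressions $\lVert\xi(x)\mid\theta(x)\wedge\psi(x)\rVert_x$; 6. neither the constant $c$ nor any symbol of $\varphi_0$ occurs in $\theta$ or $\xi$. (In 3 and 4, $\varphi$ and $\psi$ may have further free variables, bound elsewhere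 in $\mathrm{KB}$; the entailments are then required under every valuation of these variables.) Assume that for all sufficiently small $\vec\tau$, $\mathrm{KB}[\vec\tau]\models\lVert\theta(x)\mid\varphi_0(x)\rVert_x\in[a,b]$. Then $\Pr_\infty(\theta(c)\mid\mathrm{KB})\in[a,b]$, provided this degree of belief exists. -/

import Mathlib

universe u v w

namespace RandomWorlds

open Filter Topology

/-- The symbols (function, constant symbols) that occur in a first-order term. -/
def termSymbols {L : FirstOrder.Language.{u, v}} {α : Type w} : L.Term α → Set L.Symbols
  | .var _ => ∅
  | .func f ts => insert (Sum.inl ⟨_, f⟩) (⋃ i, termSymbols (ts i))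

mutual
/-- Formulas of the statistical language `L^≈` whose free variables are among
`x_0, …, x_(n-1)`; a binder of `k` variables binds `x_n, …, x_(n+k-1)` in its body. -/
inductive Form (L : FirstOrder.Language.{u, v}) : ℕ → Type (max u v)
  | eq {n : ℕ} (s t : L.Term (Fin n)) : Form L n
  | rel {n r : ℕ} (R : L.Relations r) (ts : Fin r → L.Term (Fin n)) : Form L n
  | not {n : ℕ} (φ : Form L n) : Form L n
  | and {n : ℕ} (φ ψ : Form L n) : Form L n
  | all {n : ℕ} (φ : Form L (n + 1)) : Form L n
  /-- `ζ ≈_i ζ'` -/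
  | approx {n : ℕ} (i : ℕ) (ζ ζ' : Expr L n) : Form L n
  /-- `ζ ⪯_i ζ'` -/
  | prec {n : ℕ} (i : ℕ) (ζ ζ' : Expr L n) : Form L n

/-- Proportion expressions with free variables among `x_0, …, x_(n-1)`. -/
inductive Expr (L : FirstOrder.Language.{u, v}) : ℕ → Type (max u v)
  | const {n : ℕ} (q : ℝ) : Expr L n
  | add {n : ℕ} (ζ ζ' : Expr L n) : Expr L n
  | mul {n : ℕ} (ζ ζ' : Expr L n) : Expr L n
  /-- `‖ψ | φ‖_X` with `X = {x_n, …, x_(n+k-1)}` -/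
  | cond {n : ℕ} (k : ℕ) (ψ φ : Form L (n + k)) : Expr L n
end

/-- `φ ⇒ ψ` -/
def Form.imp {L : FirstOrder.Language.{u, v}} {n : ℕ} (φ ψ : Form L n) : Form L n :=
  .not (.and φ (.not ψ))

/-- The valid sentence `true`. -/
def Form.verum {L : FirstOrder.Language.{u, v}} {n : ℕ} : Form L n :=
  .all (.eq (.var (Fin.last n)) (.var (Fin.last n)))

/-- The unconditional proportion `‖ψ‖_X`, i.e. `‖ψ | true‖_X`. -/
def Expr.prop {L : FirstOrder.Language.{u, v}} {n : ℕ} (k : ℕ) (ψ : Form L (n + k)) : Expr L n :=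
  .cond k ψ .verum

mutual
/-- The non-logical symbols occurring in a formula. -/
def Form.symbols {L : FirstOrder.Language.{u, v}} {n : ℕ} : Form L n → Set L.Symbols
  | .eq s t => termSymbols s ∪ termSymbols t
  | .rel R ts => insert (Sum.inr ⟨_, R⟩) (⋃ i, termSymbols (ts i))
  | .not φ => φ.symbols
  | .and φ ψ => φ.symbols ∪ ψ.symbols
  | .all φ => φ.symbols
  | .approx _ ζ ζ' => ζ.symbols ∪ ζ'.symbols
  | .prec _ ζ ζ' => ζ.symbols ∪ ζ'.symbols

/-- The non-logical symbols occurring in a proportion expression. -/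
def Expr.symbols {L : FirstOrder.Language.{u, v}} {n : ℕ} : Expr L n → Set L.Symbols
  | .const _ => ∅
  | .add ζ ζ' => ζ.symbols ∪ ζ'.symbols
  | .mul ζ ζ' => ζ.symbols ∪ ζ'.symbols
  | .cond _ ψ φ => ψ.symbols ∪ φ.symbols
end

/-- Extension of a substitution to `k` further variables, which stay fixed. -/
def liftSubst {L : FirstOrder.Language.{u, v}} {n m : ℕ} (k : ℕ) (σ : Fin n → L.Term (Fin m)) :
    Fin (n + k) → L.Term (Fin (m + k)) :=
  Fin.append (fun i => (σ i).relabel (Fin.castAdd k)) (fun j => .var (Fin.natAdd m j))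

mutual
/-- Simultaneous capture-avoiding substitution of terms for the free variables. -/
def Form.subst {L : FirstOrder.Language.{u, v}} {n m : ℕ} :
    Form L n → (Fin n → L.Term (Fin m)) → Form L m
  | .eq s t, σ => .eq (s.subst σ) (t.subst σ)
  | .rel R ts, σ => .rel R (fun i => (ts i).subst σ)
  | .not φ, σ => .not (φ.subst σ)
  | .and φ ψ, σ => .and (φ.subst σ) (ψ.subst σ)
  | .all φ, σ => .all (φ.subst (liftSubst 1 σ))
  | .approx i ζ ζ', σ => .approx i (ζ.subst σ) (ζ'.subst σ)
  | .prec i ζ ζ', σ => .prec i (ζ.subst σ) (ζ'.subst σ)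

/-- Substitution in proportion expressions. -/
def Expr.subst {L : FirstOrder.Language.{u, v}} {n m : ℕ} :
    Expr L n → (Fin n → L.Term (Fin m)) → Expr L m
  | .const q, _ => .const q
  | .add ζ ζ', σ => .add (ζ.subst σ) (ζ'.subst σ)
  | .mul ζ ζ', σ => .mul (ζ.subst σ) (ζ'.subst σ)
  | .cond k ψ φ, σ => .cond k (ψ.subst (liftSubst k σ)) (φ.subst (liftSubst k σ))
end

/-- The sentence `θ(c)`. -/
def Form.atConst {L : FirstOrder.Language.{u, v}} (θ : Form L 1) (c : L.Constants) : Form L 0 :=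
  θ.subst (fun _ => FirstOrder.Language.Constants.term c)

/-- The formula `θ(x)` in the scope of `n` other variables, where `x = x_n` is the variable that
the next binder binds. -/
def Form.atVar {L : FirstOrder.Language.{u, v}} (θ : Form L 1) (n : ℕ) : Form L (n + 1) :=
  θ.subst (fun _ => .var (Fin.last n))

/-- `∀ x (ξ(x) ⇒ θ(x))`, in the scope of `n` other variables. -/
def Form.link {L : FirstOrder.Language.{u, v}} (ξ θ : Form L 1) (n : ℕ) : Form L n :=
  .all ((ξ.atVar n).imp (θ.atVar n))

/-- A tolerance vector: `τ_0, τ_1, …`, all positive. These are ordered coordinatewise, so that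
"for all sufficiently small `τ`" and "`τ → 0`" are expressed by the filter `atBot`. -/
abbrev Tolerance : Type := ℕ → Set.Ioi (0 : ℝ)

mutual
/-- `(W, V, τ) ⊨ φ`, where the world `W` is the structure on `M`. A comparison one of whose sides
is undefined (because it contains a conditional proportion whose condition is satisfied by no
tuple) counts as true, as it does when the denominators are multiplied out. -/
def Form.Realize {L : FirstOrder.Language.{u, v}} {M : Type w} [L.Structure M] (τ : Tolerance) {n : ℕ} :
    Form L n → (Fin n → M) → Prop
  | .eq s t, V => s.realize V = t.realize V
  | .rel R ts, V => FirstOrder.Language.Structure.RelMap R (fun i => (ts i).realize V)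
  | .not φ, V => ¬ φ.Realize τ V
  | .and φ ψ, V => φ.Realize τ V ∧ ψ.Realize τ V
  | .all φ, V => ∀ a : M, φ.Realize τ (Fin.append V (fun _ : Fin 1 => a))
  | .approx i ζ ζ', V =>
      ∀ r r' : ℝ, ζ.HasValue τ V r → ζ'.HasValue τ V r' → |r - r'| ≤ (τ i : ℝ)
  | .prec i ζ ζ', V =>
      ∀ r r' : ℝ, ζ.HasValue τ V r → ζ'.HasValue τ V r' → r ≤ r' + (τ i : ℝ)

/-- The proportion expression is defined in `(W, V, τ)` and has the value `r`. -/
def Expr.HasValue {L : FirstOrder.Language.{u, v}} {M : Type w} [L.Structure M] (τ : Tolerance) {n : ℕ} :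
    Expr L n → (Fin n → M) → ℝ → Prop
  | .const q, _, r => r = q
  | .add ζ ζ', V, r => ∃ s s' : ℝ, ζ.HasValue τ V s ∧ ζ'.HasValue τ V s' ∧ r = s + s'
  | .mul ζ ζ', V, r => ∃ s s' : ℝ, ζ.HasValue τ V s ∧ ζ'.HasValue τ V s' ∧ r = s * s'
  | .cond k ψ φ, V, r =>
      {X : Fin k → M | φ.Realize τ (Fin.append V X)}.Nonempty ∧
      r = (Set.ncard {X : Fin k → M |
              ψ.Realize τ (Fin.append V X) ∧ φ.Realize τ (Fin.append V X)} : ℝ) /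
          (Set.ncard {X : Fin k → M | φ.Realize τ (Fin.append V X)} : ℝ)
end

/-- A world of size `N`: an interpretation of the vocabulary over a fixed domain of `N` elements. -/
abbrev World (L : FirstOrder.Language.{u, v}) (N : ℕ) : Type (max u v) := L.Structure (Fin N)

/-- `(W, τ) ⊨ KB` for a sentence `KB`; equivalently `W ⊨ KB[τ]`. -/
def Models {L : FirstOrder.Language.{u, v}} {N : ℕ} (W : World L N) (τ : Tolerance) (KB : Form L 0) : Prop :=
  letI := W
  KB.Realize τ (Fin.elim0 : Fin 0 → Fin N)

/-- `KB ⊨ φ`: in every world (of any positive finite size) and for every tolerance vector for which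
`KB` holds, `φ` holds, under every valuation of the free variables of `φ`. -/
def Entails {L : FirstOrder.Language.{u, v}} (KB : Form L 0) {n : ℕ} (φ : Form L n) : Prop :=
  ∀ N : ℕ, 0 < N → ∀ (W : World L N) (τ : Tolerance), Models W τ KB →
    ∀ V : Fin n → Fin N, letI := W; φ.Realize τ V

/-- `KB[τ] ⊨ ζ ∈ [a, b]` for a closed proportion expression `ζ`. -/
def EntailsMem {L : FirstOrder.Language.{u, v}} (KB : Form L 0) (τ : Tolerance) (ζ : Expr L 0) (a b : ℝ) :
    Prop :=
  ∀ N : ℕ, 0 < N → ∀ W : World L N, Models W τ KB →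
    ∀ r : ℝ, (letI := W; ζ.HasValue τ (Fin.elim0 : Fin 0 → Fin N) r) → r ∈ Set.Icc a b

/-- The number of worlds of size `N` in which `KB[τ]` holds. -/
noncomputable def numWorlds {L : FirstOrder.Language.{u, v}} (N : ℕ) (τ : Tolerance) (KB : Form L 0) : ℕ :=
  Set.ncard {W : World L N | Models W τ KB}

/-- `Pr_N^τ(φ | KB)` (meaningful when some world of size `N` satisfies `KB[τ]`). -/
noncomputable def prob {L : FirstOrder.Language.{u, v}} (N : ℕ) (τ : Tolerance) (φ KB : Form L 0) : ℝ :=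
  (numWorlds N τ (φ.and KB) : ℝ) / (numWorlds N τ KB : ℝ)

/-- For all sufficiently small `τ` and all sufficiently large `N`, some world of size `N` satisfies
`KB[τ]`. -/
def EventuallyConsistent {L : FirstOrder.Language.{u, v}} (KB : Form L 0) : Prop :=
  ∀ᶠ τ : Tolerance in atBot, ∀ᶠ N : ℕ in atTop, 0 < numWorlds N τ KB

/-- The degree of belief `Pr_∞(φ | KB)` exists and equals `p`: `KB` is eventually consistent, and
`lim_{τ → 0} liminf_{N → ∞} Pr_N^τ(φ | KB)` and `lim_{τ → 0} limsup_{N → ∞} Pr_N^τ(φ | KB)` both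
exist and are equal to `p`. -/
def IsDegreeOfBelief {L : FirstOrder.Language.{u, v}} (φ KB : Form L 0) (p : ℝ) : Prop :=
  EventuallyConsistent KB ∧
  Tendsto (fun τ : Tolerance => liminf (fun N : ℕ => prob N τ φ KB) atTop) atBot (𝓝 p) ∧
  Tendsto (fun τ : Tolerance => limsup (fun N : ℕ => prob N τ φ KB) atTop) atBot (𝓝 p)

mutual
/-- The one-variable proportion expression `‖ψ | φ‖_x` (in the scope of `m` other variables) occurs
in a formula. -/
inductive Form.Occurs {L : FirstOrder.Language.{u, v}} {m : ℕ} (ψ φ : Form L (m + 1)) :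
    ∀ {n : ℕ}, Form L n → Prop
  | not {n : ℕ} {χ : Form L n} : Form.Occurs ψ φ χ → Form.Occurs ψ φ (.not χ)
  | and_left {n : ℕ} {χ χ' : Form L n} : Form.Occurs ψ φ χ → Form.Occurs ψ φ (.and χ χ')
  | and_right {n : ℕ} {χ χ' : Form L n} : Form.Occurs ψ φ χ' → Form.Occurs ψ φ (.and χ χ')
  | all {n : ℕ} {χ : Form L (n + 1)} : Form.Occurs ψ φ χ → Form.Occurs ψ φ (.all χ)
  | approx_left {n i : ℕ} {ζ ζ' : Expr L n} :
      Expr.Occurs ψ φ ζ → Form.Occurs ψ φ (.approx i ζ ζ')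
  | approx_right {n i : ℕ} {ζ ζ' : Expr L n} :
      Expr.Occurs ψ φ ζ' → Form.Occurs ψ φ (.approx i ζ ζ')
  | prec_left {n i : ℕ} {ζ ζ' : Expr L n} :
      Expr.Occurs ψ φ ζ → Form.Occurs ψ φ (.prec i ζ ζ')
  | prec_right {n i : ℕ} {ζ ζ' : Expr L n} :
      Expr.Occurs ψ φ ζ' → Form.Occurs ψ φ (.prec i ζ ζ')

/-- The one-variable proportion expression `‖ψ | φ‖_x` (in the scope of `m` other variables) occurs
in a proportion expression. -/
inductive Expr.Occurs {L : FirstOrder.Language.{u, v}} {m : ℕ} (ψ φ : Form L (m + 1)) :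
    ∀ {n : ℕ}, Expr L n → Prop
  | self : Expr.Occurs ψ φ (.cond 1 ψ φ : Expr L m)
  | add_left {n : ℕ} {ζ ζ' : Expr L n} : Expr.Occurs ψ φ ζ → Expr.Occurs ψ φ (.add ζ ζ')
  | add_right {n : ℕ} {ζ ζ' : Expr L n} : Expr.Occurs ψ φ ζ' → Expr.Occurs ψ φ (.add ζ ζ')
  | mul_left {n : ℕ} {ζ ζ' : Expr L n} : Expr.Occurs ψ φ ζ → Expr.Occurs ψ φ (.mul ζ ζ')
  | mul_right {n : ℕ} {ζ ζ' : Expr L n} : Expr.Occurs ψ φ ζ' → Expr.Occurs ψ φ (.mul ζ ζ')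
  | cond_left {n k : ℕ} {χ χ' : Form L (n + k)} :
      Form.Occurs ψ φ χ → Expr.Occurs ψ φ (.cond k χ χ')
  | cond_right {n k : ℕ} {χ χ' : Form L (n + k)} :
      Form.Occurs ψ φ χ' → Expr.Occurs ψ φ (.cond k χ χ')
end

mutual
/-- The symbols of `θ` and of `ξ` occur in the formula only in the following places: in
subformulas `∀ x (ξ(x) ⇒ θ(x))`; in the `θ` of proportion expressions `‖θ(x) | φ(x)‖_x`; in the
`ξ` and in the displayed `θ` of proportion expressions `‖ξ(x) | θ(x) ∧ ψ(x)‖_x`. -/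
inductive Form.OnlyAllowed {L : FirstOrder.Language.{u, v}} (θ ξ : Form L 1) :
    ∀ {n : ℕ}, Form L n → Prop
  | link {n : ℕ} : Form.OnlyAllowed θ ξ (Form.link ξ θ n)
  | eq {n : ℕ} {s t : L.Term (Fin n)} :
      Disjoint (Form.eq s t).symbols (θ.symbols ∪ ξ.symbols) → Form.OnlyAllowed θ ξ (.eq s t)
  | rel {n r : ℕ} {R : L.Relations r} {ts : Fin r → L.Term (Fin n)} :
      Disjoint (Form.rel R ts).symbols (θ.symbols ∪ ξ.symbols) →
      Form.OnlyAllowed θ ξ (.rel R ts)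
  | not {n : ℕ} {χ : Form L n} : Form.OnlyAllowed θ ξ χ → Form.OnlyAllowed θ ξ (.not χ)
  | and {n : ℕ} {χ χ' : Form L n} :
      Form.OnlyAllowed θ ξ χ → Form.OnlyAllowed θ ξ χ' → Form.OnlyAllowed θ ξ (.and χ χ')
  | all {n : ℕ} {χ : Form L (n + 1)} : Form.OnlyAllowed θ ξ χ → Form.OnlyAllowed θ ξ (.all χ)
  | approx {n i : ℕ} {ζ ζ' : Expr L n} :
      Expr.OnlyAllowed θ ξ ζ → Expr.OnlyAllowed θ ξ ζ' → Form.OnlyAllowed θ ξ (.approx i ζ ζ')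
  | prec {n i : ℕ} {ζ ζ' : Expr L n} :
      Expr.OnlyAllowed θ ξ ζ → Expr.OnlyAllowed θ ξ ζ' → Form.OnlyAllowed θ ξ (.prec i ζ ζ')

/-- The same for proportion expressions. -/
inductive Expr.OnlyAllowed {L : FirstOrder.Language.{u, v}} (θ ξ : Form L 1) :
    ∀ {n : ℕ}, Expr L n → Prop
  | theta {n : ℕ} {φ : Form L (n + 1)} :
      Form.OnlyAllowed θ ξ φ → Expr.OnlyAllowed θ ξ (.cond 1 (θ.atVar n) φ)
  | xi {n : ℕ} {ψ : Form L (n + 1)} :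
      Form.OnlyAllowed θ ξ ψ → Expr.OnlyAllowed θ ξ (.cond 1 (ξ.atVar n) (.and (θ.atVar n) ψ))
  | const {n : ℕ} {q : ℝ} : Expr.OnlyAllowed θ ξ (.const q : Expr L n)
  | add {n : ℕ} {ζ ζ' : Expr L n} :
      Expr.OnlyAllowed θ ξ ζ → Expr.OnlyAllowed θ ξ ζ' → Expr.OnlyAllowed θ ξ (.add ζ ζ')
  | mul {n : ℕ} {ζ ζ' : Expr L n} :
      Expr.OnlyAllowed θ ξ ζ → Expr.OnlyAllowed θ ξ ζ' → Expr.OnlyAllowed θ ξ (.mul ζ ζ')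
  | cond {n k : ℕ} {χ χ' : Form L (n + k)} :
      Form.OnlyAllowed θ ξ χ → Form.OnlyAllowed θ ξ χ' → Expr.OnlyAllowed θ ξ (.cond k χ χ')
end

/-- `KB ⊨ ∀ x (φ₀(x) ⇒ φ(x))` or `KB ⊨ ∀ x (φ₀(x) ⇒ ¬ φ(x))`. -/
def Decides {L : FirstOrder.Language.{u, v}} (KB : Form L 0) (φ₀ : Form L 1) {n : ℕ} (φ : Form L (n + 1)) :
    Prop :=
  Entails KB (Form.all ((φ₀.atVar n).imp φ)) ∨ Entails KB (Form.all ((φ₀.atVar n).imp φ.not))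

end RandomWorlds

-- The bound already holds at every fixed `N` and `τ` for which `KB[τ]` has a world; the limits only
-- inherit it. Let `T` be the set of symbols of `θ` and `ξ`. For a world `W` of `KB` and an element
-- `d` of the extension of `φ₀`, transport the interpretations of the symbols in `T` along the
-- transposition of `d` and the denotation of `c`, and keep all other interpretations.
--
-- The new world still satisfies `KB` (`Form.OnlyAllowed.realize_twist`). The extensions of `θ` and
-- `ξ` are moved by the transposition, which changes no proportion in `KB`: each side condition `φ`
-- or `ψ` is constantly true or constantly false on `φ₀`, and so is invariant under a permutation
-- that moves points only inside `φ₀`. The denotation of `c` and the extension of `φ₀` do not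
-- change, since they involve no symbol of `T`.
--
-- For fixed `d` this exchange is therefore an involution on the worlds of `KB` with `d` in `φ₀`,
-- and it turns "`θ` holds of `c`" into "`θ` holds of `d`". Double counting
-- (`div_mem_Icc_of_exchange`) shows that the probability of `θ(c)` is the average over the worlds
-- of `KB` of the proportion of `θ` in `φ₀`, and each of these proportions lies in `[a, b]`.

namespace RandomWorlds

open FirstOrder FirstOrder.Language

-- Semantics: invariance under isomorphisms of reducts, and substitution.

section Realize

variable {L : FirstOrder.Language.{u, v}} {M : Type w}

/-- The map `e` commutes with the interpretations of the symbols in `T` in two structures. -/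
structure IsoOn (T : Set L.Symbols) (S S' : L.Structure M) (e : Equiv.Perm M) : Prop where
  map_fun : ∀ {n : ℕ} (f : L.Functions n), (Sum.inl ⟨n, f⟩ : L.Symbols) ∈ T →
    ∀ x : Fin n → M, e (S.funMap f x) = S'.funMap f (fun i => e (x i))
  map_rel : ∀ {n : ℕ} (R : L.Relations n), (Sum.inr ⟨n, R⟩ : L.Symbols) ∈ T →
    ∀ x : Fin n → M, S.RelMap R x ↔ S'.RelMap R (fun i => e (x i))

theorem IsoOn.realize_term {T : Set L.Symbols} {S S' : L.Structure M} {e : Equiv.Perm M}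
    (h : IsoOn T S S' e) {α : Type*} (t : L.Term α) (ht : termSymbols t ⊆ T) (V : α → M) :
    e (@Term.realize L M S α V t) = @Term.realize L M S' α (fun i => e (V i)) t := by
  induction t with
  | var i => rfl
  | func f ts ih =>
    simp only [termSymbols, Set.insert_subset_iff, Set.iUnion_subset_iff] at ht
    simp only [Term.realize]
    rw [h.map_fun f ht.1]
    congr 1
    funext i
    exact ih i (ht.2 i)

theorem comp_append (e : M → M) {n k : ℕ} (V : Fin n → M) (X : Fin k → M) :
    (fun i => e (Fin.append V X i)) = Fin.append (fun i => e (V i)) (fun i => e (X i)) := by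
  funext i
  refine Fin.addCases (fun i => ?_) (fun i => ?_) i <;> simp

/-- A permutation of the tuples carries the numerator and denominator sets of one proportion onto
those of the other, so the cardinalities agree and so does definedness. -/
theorem proportion_congr {α : Type*} (E : Equiv.Perm α) {A A' B B' : α → Prop} {r : ℝ}
    (hB : ∀ x, B x ↔ B' (E x)) (hA : ∀ x, B x → (A x ↔ A' (E x))) :
    ({x | B x}.Nonempty ∧ r = (Set.ncard {x | A x ∧ B x} : ℝ) / (Set.ncard {x | B x} : ℝ)) ↔
    ({x | B' x}.Nonempty ∧ r = (Set.ncard {x | A' x ∧ B' x} : ℝ) / (Set.ncard {x | B' x} : ℝ)) := by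
  have h1 : {x | B' x} = E '' {x | B x} := by
    ext y
    obtain ⟨x, rfl⟩ := E.surjective y
    simp [hB]
  have h2 : {x | A' x ∧ B' x} = E '' {x | A x ∧ B x} := by
    ext y
    obtain ⟨x, rfl⟩ := E.surjective y
    have := hA x
    have := hB x
    simp only [Set.mem_ofPred_eq, EmbeddingLike.apply_eq_iff_eq, Set.mem_image, exists_eq_right]
    tauto
  rw [h1, h2, Set.ncard_image_of_injective _ E.injective, Set.ncard_image_of_injective _ E.injective,
    Set.image_nonempty]

mutual
-- Truth depends only on the symbols that occur, and quantifiers and tuple counts can be reindexed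
-- by `e`. Two cases are needed later: a transposition on the transported symbols, and the identity
-- on the complementary symbols.
theorem IsoOn.realize_iff {T : Set L.Symbols} {S S' : L.Structure M} {e : Equiv.Perm M}
    (h : IsoOn T S S' e) (τ : Tolerance) {n : ℕ} :
    ∀ (χ : Form L n) (_ : χ.symbols ⊆ T) (V : Fin n → M),
      @Form.Realize L M S τ n χ V ↔ @Form.Realize L M S' τ n χ (fun i => e (V i))
  | .eq s t, hs, V => by
    simp only [Form.symbols, Set.union_subset_iff] at hs
    simp only [Form.Realize]
    rw [← h.realize_term s hs.1, ← h.realize_term t hs.2, e.apply_eq_iff_eq]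
  | .rel R ts, hs, V => by
    simp only [Form.symbols, Set.insert_subset_iff, Set.iUnion_subset_iff] at hs
    simp only [Form.Realize]
    rw [h.map_rel R hs.1]
    simp only [fun i => h.realize_term (ts i) (hs.2 i) V]
  | .not φ, hs, V => by
    simp only [Form.symbols] at hs
    simp only [Form.Realize]
    rw [h.realize_iff τ φ hs V]
  | .and φ ψ, hs, V => by
    simp only [Form.symbols, Set.union_subset_iff] at hs
    simp only [Form.Realize]
    rw [h.realize_iff τ φ hs.1 V, h.realize_iff τ ψ hs.2 V]
  | .all φ, hs, V => by
    simp only [Form.symbols] at hs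
    simp only [Form.Realize]
    refine e.forall_congr fun a => ?_
    rw [h.realize_iff τ φ hs, comp_append]
  | .approx i ζ ζ', hs, V => by
    simp only [Form.symbols, Set.union_subset_iff] at hs
    simp only [Form.Realize]
    simp only [h.hasValue_iff τ ζ hs.1 V, h.hasValue_iff τ ζ' hs.2 V]
  | .prec i ζ ζ', hs, V => by
    simp only [Form.symbols, Set.union_subset_iff] at hs
    simp only [Form.Realize]
    simp only [h.hasValue_iff τ ζ hs.1 V, h.hasValue_iff τ ζ' hs.2 V]

theorem IsoOn.hasValue_iff {T : Set L.Symbols} {S S' : L.Structure M} {e : Equiv.Perm M}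
    (h : IsoOn T S S' e) (τ : Tolerance) {n : ℕ} :
    ∀ (ζ : Expr L n) (_ : ζ.symbols ⊆ T) (V : Fin n → M) (r : ℝ),
      @Expr.HasValue L M S τ n ζ V r ↔ @Expr.HasValue L M S' τ n ζ (fun i => e (V i)) r
  | .const q, _, V, r => by simp only [Expr.HasValue]
  | .add ζ ζ', hs, V, r => by
    simp only [Expr.symbols, Set.union_subset_iff] at hs
    simp only [Expr.HasValue]
    simp only [h.hasValue_iff τ ζ hs.1 V, h.hasValue_iff τ ζ' hs.2 V]
  | .mul ζ ζ', hs, V, r => by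
    simp only [Expr.symbols, Set.union_subset_iff] at hs
    simp only [Expr.HasValue]
    simp only [h.hasValue_iff τ ζ hs.1 V, h.hasValue_iff τ ζ' hs.2 V]
  | .cond k ψ φ, hs, V, r => by
    simp only [Expr.symbols, Set.union_subset_iff] at hs
    simp only [Expr.HasValue]
    refine proportion_congr (Equiv.piCongrRight fun _ => e) (fun X => ?_) (fun X _ => ?_)
    · rw [h.realize_iff τ φ hs.2, comp_append]; rfl
    · rw [h.realize_iff τ ψ hs.1, comp_append]; rfl
end

theorem realize_liftSubst [L.Structure M] {n m k : ℕ} (σ : Fin n → L.Term (Fin m))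
    (V : Fin m → M) (X : Fin k → M) :
    (fun i => (liftSubst k σ i).realize (Fin.append V X)) =
      Fin.append (fun i => (σ i).realize V) X := by
  funext i
  refine Fin.addCases (fun i => ?_) (fun i => ?_) i
  · simp only [liftSubst, Fin.append_left, Term.realize_relabel]
    congr 1
    funext j
    simp
  · simp [liftSubst]

mutual
theorem Form.realize_subst [L.Structure M] (τ : Tolerance) {n m : ℕ} :
    ∀ (χ : Form L n) (σ : Fin n → L.Term (Fin m)) (V : Fin m → M),
      (χ.subst σ).Realize τ V ↔ χ.Realize τ (fun i => (σ i).realize V)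
  | .eq s t, σ, V => by simp only [Form.subst, Form.Realize, Term.realize_subst]
  | .rel R ts, σ, V => by simp only [Form.subst, Form.Realize, Term.realize_subst]
  | .not φ, σ, V => by simp only [Form.subst, Form.Realize, Form.realize_subst τ φ]
  | .and φ ψ, σ, V => by
    simp only [Form.subst, Form.Realize, Form.realize_subst τ φ, Form.realize_subst τ ψ]
  | .all φ, σ, V => by
    simp only [Form.subst, Form.Realize, Form.realize_subst τ φ, realize_liftSubst]
  | .approx i ζ ζ', σ, V => by
    simp only [Form.subst, Form.Realize, Expr.hasValue_subst τ ζ, Expr.hasValue_subst τ ζ']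
  | .prec i ζ ζ', σ, V => by
    simp only [Form.subst, Form.Realize, Expr.hasValue_subst τ ζ, Expr.hasValue_subst τ ζ']

theorem Expr.hasValue_subst [L.Structure M] (τ : Tolerance) {n m : ℕ} :
    ∀ (ζ : Expr L n) (σ : Fin n → L.Term (Fin m)) (V : Fin m → M) (r : ℝ),
      (ζ.subst σ).HasValue τ V r ↔ ζ.HasValue τ (fun i => (σ i).realize V) r
  | .const q, σ, V, r => by simp only [Expr.subst, Expr.HasValue]
  | .add ζ ζ', σ, V, r => by
    simp only [Expr.subst, Expr.HasValue, Expr.hasValue_subst τ ζ, Expr.hasValue_subst τ ζ']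
  | .mul ζ ζ', σ, V, r => by
    simp only [Expr.subst, Expr.HasValue, Expr.hasValue_subst τ ζ, Expr.hasValue_subst τ ζ']
  | .cond k ψ φ, σ, V, r => by
    simp only [Expr.subst, Expr.HasValue, Form.realize_subst τ ψ, Form.realize_subst τ φ,
      realize_liftSubst]
end

/-- The element `a` has the property expressed by `χ`. -/
def Form.Holds (S : L.Structure M) (τ : Tolerance) (χ : Form L 1) (a : M) : Prop :=
  @Form.Realize L M S τ 1 χ (fun _ => a)

theorem Form.realize_atVar [S : L.Structure M] (τ : Tolerance) (χ : Form L 1) {n : ℕ}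
    (V : Fin n → M) (X : Fin 1 → M) :
    (χ.atVar n).Realize τ (Fin.append V X) ↔ χ.Holds S τ (X 0) := by
  have : Fin.append V X (Fin.last n) = X 0 := Fin.append_right V X 0
  simp only [Form.atVar, Form.realize_subst, Term.realize_var, this, Form.Holds]

theorem Form.realize_atConst [S : L.Structure M] (τ : Tolerance) (χ : Form L 1) (c : L.Constants)
    (V : Fin 0 → M) : (χ.atConst c).Realize τ V ↔ χ.Holds S τ (c : M) := by
  simp only [Form.atConst, Form.realize_subst, Term.realize_constants, Form.Holds]

theorem Form.realize_imp [L.Structure M] (τ : Tolerance) {n : ℕ} (φ ψ : Form L n) (V : Fin n → M) :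
    (φ.imp ψ).Realize τ V ↔ (φ.Realize τ V → ψ.Realize τ V) := by
  simp only [Form.imp, Form.Realize]
  tauto

theorem Form.realize_link [S : L.Structure M] (τ : Tolerance) (ξ θ : Form L 1) {n : ℕ}
    (V : Fin n → M) :
    (Form.link ξ θ n).Realize τ V ↔ ∀ a : M, ξ.Holds S τ a → θ.Holds S τ a := by
  simp only [Form.link, Form.Realize, Form.realize_imp, Form.realize_atVar]

theorem IsoOn.holds_iff {T : Set L.Symbols} {S S' : L.Structure M} {e : Equiv.Perm M}
    (h : IsoOn T S S' e) (τ : Tolerance) (χ : Form L 1) (hχ : χ.symbols ⊆ T) (a : M) :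
    χ.Holds S τ a ↔ χ.Holds S' τ (e a) :=
  h.realize_iff τ χ hχ _

/-- The extension of `φ` in its last variable is invariant under `e`, for all values of the other
variables. -/
def Form.Invariant (S : L.Structure M) (τ : Tolerance) (e : M → M) {n : ℕ} (φ : Form L (n + 1)) :
    Prop :=
  ∀ (V : Fin n → M) (X : Fin 1 → M), @Form.Realize L M S τ (n + 1) φ (Fin.append V X) ↔
    @Form.Realize L M S τ (n + 1) φ (Fin.append V (fun i => e (X i)))

end Realize

-- Transporting some of the symbols along a permutation.

section Twist

variable {L : FirstOrder.Language.{u, v}} {M : Type w}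

open Classical in
/-- The interpretations of the symbols in `T` are transported along `e`, the other ones are kept. -/
@[reducible] noncomputable def twist (T : Set L.Symbols) (e : Equiv.Perm M) (S : L.Structure M) :
    L.Structure M where
  funMap {n} f x := if (Sum.inl ⟨n, f⟩ : L.Symbols) ∈ T then e (S.funMap f (fun i => e.symm (x i)))
    else S.funMap f x
  RelMap {n} R x := if (Sum.inr ⟨n, R⟩ : L.Symbols) ∈ T then S.RelMap R (fun i => e.symm (x i))
    else S.RelMap R x

section

variable (T : Set L.Symbols) (e : Equiv.Perm M) (S : L.Structure M) {n : ℕ}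

theorem twist_funMap_of_mem {f : L.Functions n} (hf : (Sum.inl ⟨n, f⟩ : L.Symbols) ∈ T)
    (x : Fin n → M) : (twist T e S).funMap f x = e (S.funMap f (fun i => e.symm (x i))) :=
  if_pos hf

theorem twist_funMap_of_notMem {f : L.Functions n} (hf : (Sum.inl ⟨n, f⟩ : L.Symbols) ∉ T)
    (x : Fin n → M) : (twist T e S).funMap f x = S.funMap f x :=
  if_neg hf

theorem twist_relMap_of_mem {R : L.Relations n} (hR : (Sum.inr ⟨n, R⟩ : L.Symbols) ∈ T)
    (x : Fin n → M) : (twist T e S).RelMap R x ↔ S.RelMap R (fun i => e.symm (x i)) :=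
  iff_of_eq (if_pos hR)

theorem twist_relMap_of_notMem {R : L.Relations n} (hR : (Sum.inr ⟨n, R⟩ : L.Symbols) ∉ T)
    (x : Fin n → M) : (twist T e S).RelMap R x ↔ S.RelMap R x :=
  iff_of_eq (if_neg hR)

end

theorem isoOn_twist (T : Set L.Symbols) (e : Equiv.Perm M) (S : L.Structure M) :
    IsoOn T S (twist T e S) e where
  map_fun f hf x := by simp [twist_funMap_of_mem T e S hf]
  map_rel R hR x := by simp [twist_relMap_of_mem T e S hR]

/-- With the identity as the map, valuations are not moved: a formula without symbols of `T` keeps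
its truth value at the same valuation. -/
theorem isoOn_compl_twist (T : Set L.Symbols) (e : Equiv.Perm M) (S : L.Structure M) :
    IsoOn Tᶜ S (twist T e S) 1 where
  map_fun f hf x := (twist_funMap_of_notMem T e S hf x).symm
  map_rel R hR x := (twist_relMap_of_notMem T e S hR x).symm

theorem structure_ext {S S' : L.Structure M}
    (hf : ∀ {n} (f : L.Functions n) (x : Fin n → M), S.funMap f x = S'.funMap f x)
    (hR : ∀ {n} (R : L.Relations n) (x : Fin n → M), S.RelMap R x ↔ S'.RelMap R x) : S = S' := by
  cases S
  cases S'
  congr 1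
  · funext n f x
    exact hf f x
  · funext n R x
    exact propext (hR R x)

theorem twist_symm_twist (T : Set L.Symbols) (e : Equiv.Perm M) (S : L.Structure M) :
    twist T e.symm (twist T e S) = S := by
  refine structure_ext (fun {n} f x => ?_) (fun {n} R x => ?_)
  · by_cases hf : (Sum.inl ⟨n, f⟩ : L.Symbols) ∈ T
    · simp [twist_funMap_of_mem T _ _ hf]
    · simp [twist_funMap_of_notMem T _ _ hf]
  · by_cases hR : (Sum.inr ⟨n, R⟩ : L.Symbols) ∈ T
    · simp [twist_relMap_of_mem T _ _ hR]
    · simp [twist_relMap_of_notMem T _ _ hR]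

mutual
-- The key preservation result, by induction on how the formula is allowed to be built. The
-- valuation `V` stays fixed; only the variable bound at a displayed `θ(x)` or `ξ(x)` is reindexed
-- by `e`, and there the invariance hypotheses let the side condition follow the reindexing.
theorem Form.OnlyAllowed.realize_twist {θ ξ : Form L 1} (S : L.Structure M) (τ : Tolerance)
    (e : Equiv.Perm M) : ∀ {n : ℕ} {χ : Form L n} (_ : Form.OnlyAllowed θ ξ χ)
    (_ : ∀ (m : ℕ) (φ : Form L (m + 1)), Form.Occurs (θ.atVar m) φ χ → φ.Invariant S τ e)
    (_ : ∀ (m : ℕ) (ψ : Form L (m + 1)), Form.Occurs (ξ.atVar m) ((θ.atVar m).and ψ) χ →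
      ψ.Invariant S τ e) (V : Fin n → M),
    @Form.Realize L M S τ n χ V ↔
      @Form.Realize L M (twist (θ.symbols ∪ ξ.symbols) e S) τ n χ V
  | _, _, .link, _, _, V => by
    rw [@Form.realize_link L M S, @Form.realize_link L M (twist _ e S)]
    -- The link formula has only transported symbols and no free variable, so reindexing its
    -- quantifier by `e` suffices.
    refine e.forall_congr fun a => ?_
    rw [(isoOn_twist _ e S).holds_iff τ ξ Set.subset_union_right,
      (isoOn_twist _ e S).holds_iff τ θ Set.subset_union_left]
  | _, _, .eq h, _, _, V =>
    (isoOn_compl_twist _ e S).realize_iff τ _ (Set.subset_compl_iff_disjoint_right.2 h) V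
  | _, _, .rel h, _, _, V =>
    (isoOn_compl_twist _ e S).realize_iff τ _ (Set.subset_compl_iff_disjoint_right.2 h) V
  | _, _, .not h, hθ, hξ, V => by
    simp only [Form.Realize]
    rw [h.realize_twist S τ e (fun m φ o => hθ m φ (.not o)) (fun m φ o => hξ m φ (.not o))]
  | _, _, .and h h', hθ, hξ, V => by
    simp only [Form.Realize]
    rw [h.realize_twist S τ e (fun m φ o => hθ m φ (.and_left o))
        (fun m φ o => hξ m φ (.and_left o)),
      h'.realize_twist S τ e (fun m φ o => hθ m φ (.and_right o))
        (fun m φ o => hξ m φ (.and_right o))]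
  | _, _, .all h, hθ, hξ, V => by
    simp only [Form.Realize]
    refine forall_congr' fun a => ?_
    rw [h.realize_twist S τ e (fun m φ o => hθ m φ (.all o)) (fun m φ o => hξ m φ (.all o))]
  | _, _, .approx h h', hθ, hξ, V => by
    simp only [Form.Realize]
    simp only [h.hasValue_twist S τ e (fun m φ o => hθ m φ (.approx_left o))
        (fun m φ o => hξ m φ (.approx_left o)),
      h'.hasValue_twist S τ e (fun m φ o => hθ m φ (.approx_right o))
        (fun m φ o => hξ m φ (.approx_right o))]
  | _, _, .prec h h', hθ, hξ, V => by
    simp only [Form.Realize]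
    simp only [h.hasValue_twist S τ e (fun m φ o => hθ m φ (.prec_left o))
        (fun m φ o => hξ m φ (.prec_left o)),
      h'.hasValue_twist S τ e (fun m φ o => hθ m φ (.prec_right o))
        (fun m φ o => hξ m φ (.prec_right o))]

theorem Expr.OnlyAllowed.hasValue_twist {θ ξ : Form L 1} (S : L.Structure M) (τ : Tolerance)
    (e : Equiv.Perm M) : ∀ {n : ℕ} {ζ : Expr L n} (_ : Expr.OnlyAllowed θ ξ ζ)
    (_ : ∀ (m : ℕ) (φ : Form L (m + 1)), Expr.Occurs (θ.atVar m) φ ζ → φ.Invariant S τ e)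
    (_ : ∀ (m : ℕ) (ψ : Form L (m + 1)), Expr.Occurs (ξ.atVar m) ((θ.atVar m).and ψ) ζ →
      ψ.Invariant S τ e) (V : Fin n → M) (r : ℝ),
    @Expr.HasValue L M S τ n ζ V r ↔
      @Expr.HasValue L M (twist (θ.symbols ∪ ξ.symbols) e S) τ n ζ V r
  | _, _, .theta (φ := φ) h, hθ, hξ, V, r => by
    simp only [Expr.HasValue]
    refine proportion_congr (Equiv.piCongrRight fun _ => e) (fun X => ?_) (fun X _ => ?_)
    -- The condition is first moved along `e` inside `S` by invariance, then passed to the twisted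
    -- structure by induction.
    · rw [hθ _ φ .self, h.realize_twist S τ e (fun m φ o => hθ m φ (.cond_right o))
        (fun m φ o => hξ m φ (.cond_right o))]; rfl
    · rw [@Form.realize_atVar L M S, @Form.realize_atVar L M (twist _ e S)]
      exact (isoOn_twist _ e S).holds_iff τ θ Set.subset_union_left _
  | _, _, .xi (ψ := ψ) h, hθ, hξ, V, r => by
    simp only [Expr.HasValue, Form.Realize]
    refine proportion_congr (Equiv.piCongrRight fun _ => e) (fun X => ?_) (fun X _ => ?_)
    · refine and_congr ?_ ?_
      · rw [@Form.realize_atVar L M S, @Form.realize_atVar L M (twist _ e S)]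
        exact (isoOn_twist _ e S).holds_iff τ θ Set.subset_union_left _
      · rw [hξ _ ψ .self, h.realize_twist S τ e (fun m φ o => hθ m φ (.cond_right (.and_right o)))
          (fun m φ o => hξ m φ (.cond_right (.and_right o)))]; rfl
    · rw [@Form.realize_atVar L M S, @Form.realize_atVar L M (twist _ e S)]
      exact (isoOn_twist _ e S).holds_iff τ ξ Set.subset_union_right _
  | _, _, .const, _, _, V, r => by simp only [Expr.HasValue]
  | _, _, .add h h', hθ, hξ, V, r => by
    simp only [Expr.HasValue]
    simp only [h.hasValue_twist S τ e (fun m φ o => hθ m φ (.add_left o))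
        (fun m φ o => hξ m φ (.add_left o)),
      h'.hasValue_twist S τ e (fun m φ o => hθ m φ (.add_right o))
        (fun m φ o => hξ m φ (.add_right o))]
  | _, _, .mul h h', hθ, hξ, V, r => by
    simp only [Expr.HasValue]
    simp only [h.hasValue_twist S τ e (fun m φ o => hθ m φ (.mul_left o))
        (fun m φ o => hξ m φ (.mul_left o)),
      h'.hasValue_twist S τ e (fun m φ o => hθ m φ (.mul_right o))
        (fun m φ o => hξ m φ (.mul_right o))]
  | _, _, .cond h h', hθ, hξ, V, r => by
    simp only [Expr.HasValue]
    simp only [h.realize_twist S τ e (fun m φ o => hθ m φ (.cond_left o))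
        (fun m φ o => hξ m φ (.cond_left o)),
      h'.realize_twist S τ e (fun m φ o => hθ m φ (.cond_right o))
        (fun m φ o => hξ m φ (.cond_right o))]
end

end Twist

-- Counting worlds: the exchange and the average.

section Count

variable {L : FirstOrder.Language.{u, v}}

instance finite_world [Finite L.Symbols] (N : ℕ) : Finite (World L N) := by
  have : Finite (Σ n, L.Functions n) := Finite.of_injective
    (fun f => (Sum.inl f : L.Symbols)) Sum.inl_injective
  have : Finite (Σ n, L.Relations n) := Finite.of_injective
    (fun f => (Sum.inr f : L.Symbols)) Sum.inr_injective
  refine Finite.of_injective (β := ((f : Σ n, L.Functions n) → (Fin f.1 → Fin N) → Fin N) ×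
    ((R : Σ n, L.Relations n) → (Fin R.1 → Fin N) → Prop))
    (fun W => (fun f => W.funMap f.2, fun R => W.RelMap R.2)) ?_
  intro W W' h
  simp only [Prod.mk.injEq] at h
  exact structure_ext (fun {n} f x => congrFun (congrFun h.1 ⟨n, f⟩) x)
    (fun {n} R x => iff_of_eq (congrFun (congrFun h.2 ⟨n, R⟩) x))

/-- A point moved by `e` lies in `φ₀` together with its image, and there `φ` has a constant truth
value. -/
theorem Decides.invariant {KB : Form L 0} {φ₀ : Form L 1} {n : ℕ} {φ : Form L (n + 1)}
    (h : Decides KB φ₀ φ) {N : ℕ} (hN : 0 < N) {W : World L N} {τ : Tolerance}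
    (hW : Models W τ KB) {e : Equiv.Perm (Fin N)}
    (he : ∀ x, e x = x ∨ φ₀.Holds W τ x ∧ φ₀.Holds W τ (e x)) : φ.Invariant W τ e := by
  intro V X
  have hX : X = fun _ => X 0 := by funext i; rw [Subsingleton.elim i 0]
  rw [hX]
  rcases he (X 0) with h0 | ⟨h1, h2⟩
  · simp only [h0]
  · rcases h with h | h
    · have := h N hN W τ hW V
      simp only [Form.Realize, @Form.realize_imp L _ W, @Form.realize_atVar L _ W] at this
      exact iff_of_true (this _ h1) (this _ h2)
    · have := h N hN W τ hW V
      simp only [Form.Realize, @Form.realize_imp L _ W, @Form.realize_atVar L _ W] at this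
      exact iff_of_false (this _ h1) (this _ h2)

/-- The denotation of a constant symbol in a world. -/
def denotation {N : ℕ} (W : World L N) (c : L.Constants) : Fin N :=
  letI := W
  (c : Fin N)

/-- The world in which `c` and `d` have exchanged their roles with respect to the symbols in `T`. -/
@[reducible] noncomputable def exchange {N : ℕ} (T : Set L.Symbols) (c : L.Constants) (W : World L N)
    (d : Fin N) : World L N :=
  twist T (Equiv.swap (denotation W c) d) W

theorem denotation_exchange {N : ℕ} {T : Set L.Symbols} {c : L.Constants}
    (hc : (Sum.inl ⟨0, c⟩ : L.Symbols) ∉ T) (W : World L N) (d : Fin N) :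
    denotation (exchange T c W d) c = denotation W c :=
  twist_funMap_of_notMem T _ W hc _

/-- As `c` is not transported, the second exchange uses the same transposition, which is its own
inverse. -/
theorem exchange_exchange {N : ℕ} {T : Set L.Symbols} {c : L.Constants}
    (hc : (Sum.inl ⟨0, c⟩ : L.Symbols) ∉ T) (W : World L N) (d : Fin N) :
    exchange T c (exchange T c W d) d = W := by
  have := twist_symm_twist T (Equiv.swap (denotation W c) d) W
  rw [Equiv.symm_swap] at this
  rw [exchange, denotation_exchange hc]
  exact this

open Classical in
/-- Double counting along an involution: if exchanging the distinguished element `c W` of `A W` with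
`d` is an involution of the pairs `(W, d)` with `d ∈ A W`, then the proportion of the `W` for which
`c W` has the property `Θ W` is an average of the proportions of `Θ W` in `A W`. -/
theorem div_mem_Icc_of_exchange {Ω α : Type*} [Fintype α] (K : Finset Ω) (hK : K.Nonempty)
    (A Θ : Ω → α → Prop) (c : Ω → α) (ex : Ω → α → Ω) {a b : ℝ}
    (h_c : ∀ W ∈ K, A W (c W))
    (h_mem : ∀ W ∈ K, ∀ d, A W d → ex W d ∈ K)
    (h_A : ∀ W ∈ K, ∀ d, A W d → A (ex W d) = A W)
    (h_ex : ∀ W ∈ K, ∀ d, A W d → ex (ex W d) d = W)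
    (h_Θ : ∀ W ∈ K, ∀ d, A W d → (Θ (ex W d) d ↔ Θ W (c W)))
    (h_ab : ∀ W ∈ K, ((Finset.univ.filter fun d => Θ W d ∧ A W d).card : ℝ) /
      (Finset.univ.filter (A W)).card ∈ Set.Icc a b) :
    ((K.filter fun W => Θ W (c W)).card : ℝ) / K.card ∈ Set.Icc a b := by
  -- Each `W` with `Θ W (c W)` spreads its unit weight evenly over the elements of `A W`, a set that
  -- contains `c W` and so is nonempty.
  have key : ((K.filter fun W => Θ W (c W)).card : ℝ) = ∑ W ∈ K,
      ((Finset.univ.filter fun d => Θ W d ∧ A W d).card : ℝ) / (Finset.univ.filter (A W)).card := by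
    calc ((K.filter fun W => Θ W (c W)).card : ℝ)
        = ∑ W ∈ K, ∑ d, if A W d then
            (if Θ W (c W) then 1 else 0) / ((Finset.univ.filter (A W)).card : ℝ) else 0 := by
          rw [Finset.card_filter]
          push_cast
          refine Finset.sum_congr rfl fun W hW => ?_
          have : ((Finset.univ.filter (A W)).card : ℝ) ≠ 0 :=
            Nat.cast_ne_zero.2 (Finset.card_ne_zero.2 ⟨c W, by simpa using h_c W hW⟩)
          rw [← Finset.sum_filter, Finset.sum_const, nsmul_eq_mul]
          field_simp
      _ = ∑ d, ∑ W ∈ K.filter (fun W => A W d),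
            (if Θ W (c W) then 1 else 0) / ((Finset.univ.filter (A W)).card : ℝ) := by
          rw [Finset.sum_comm]
          simp only [Finset.sum_filter]
      _ = ∑ d, ∑ W ∈ K.filter (fun W => A W d),
            (if Θ W d then 1 else 0) / ((Finset.univ.filter (A W)).card : ℝ) := by
          -- For fixed `d`, reindexing by the involution replaces `Θ W (c W)` by `Θ W d`; the weight
          -- is unchanged because `A` is.
          refine Finset.sum_congr rfl fun d _ => ?_
          have hmaps : ∀ W ∈ K.filter (fun W => A W d), ex W d ∈ K.filter (fun W => A W d) := by
            intro W hW
            rw [Finset.mem_filter] at hW ⊢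
            exact ⟨h_mem W hW.1 d hW.2, by rw [h_A W hW.1 d hW.2]; exact hW.2⟩
          have hinv : ∀ W ∈ K.filter (fun W => A W d), ex (ex W d) d = W := by
            intro W hW
            rw [Finset.mem_filter] at hW
            exact h_ex W hW.1 d hW.2
          refine Finset.sum_nbij' (fun W => ex W d) (fun W => ex W d) hmaps hmaps hinv hinv ?_
          intro W hW
          rw [Finset.mem_filter] at hW
          simp only [h_A W hW.1 d hW.2, h_Θ W hW.1 d hW.2]
      _ = _ := by
          simp only [Finset.sum_filter]
          rw [Finset.sum_comm]
          refine Finset.sum_congr rfl fun W _ => ?_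
          rw [← Finset.sum_filter, ← Finset.sum_div, ← Finset.sum_filter, Finset.filter_filter,
            Finset.sum_const, nsmul_eq_mul, mul_one]
          simp only [and_comm]
  have hpos : (0 : ℝ) < K.card := Nat.cast_pos.2 hK.card_pos
  rw [key, Set.mem_Icc, le_div_iff₀ hpos, div_le_iff₀ hpos]
  constructor
  · rw [mul_comm, ← nsmul_eq_mul]
    exact Finset.card_nsmul_le_sum _ _ _ fun W hW => (h_ab W hW).1
  · rw [mul_comm, ← nsmul_eq_mul]
    exact Finset.sum_le_card_nsmul _ _ _ fun W hW => (h_ab W hW).2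

/-- The value of a proportion expression `‖θ(x) | φ(x)‖_x` without further free variables. -/
theorem hasValue_cond_atVar {M : Type w} [S : L.Structure M] (τ : Tolerance) (θ φ : Form L 1)
    (V : Fin 0 → M) {a : M} (ha : φ.Holds S τ a) :
    (Expr.cond 1 (θ.atVar 0) (φ.atVar 0)).HasValue τ V
      ((Set.ncard {x | θ.Holds S τ x ∧ φ.Holds S τ x} : ℝ) / Set.ncard {x | φ.Holds S τ x}) := by
  simp only [Expr.HasValue, Form.realize_atVar]
  have h : ∀ P : M → Prop, Set.ncard {X : Fin 1 → M | P (X 0)} = Set.ncard {x | P x} := by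
    intro P
    rw [← Set.ncard_image_of_injective _ (Equiv.funUnique (Fin 1) M).injective]
    congr 1
    ext x
    exact ⟨fun ⟨X, hX, h⟩ => h ▸ hX, fun hx => ⟨fun _ => x, hx, rfl⟩⟩
  exact ⟨⟨fun _ => a, ha⟩, by rw [h fun x => θ.Holds S τ x ∧ φ.Holds S τ x, h (φ.Holds S τ)]⟩

/-- The bound at fixed size and tolerance. Positivity of the number of worlds excludes the default
value `0 / 0 = 0`, which might lie outside the interval. -/
theorem prob_mem_Icc [Finite L.Symbols] (KB : Form L 0) (c : L.Constants) (φ₀ θ ξ : Form L 1)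
    {a b : ℝ} (h_c : Entails KB (φ₀.atConst c))
    (h_theta : ∀ (n : ℕ) (φ : Form L (n + 1)), Form.Occurs (θ.atVar n) φ KB → Decides KB φ₀ φ)
    (h_xi : ∀ (n : ℕ) (ψ : Form L (n + 1)),
      Form.Occurs (ξ.atVar n) ((θ.atVar n).and ψ) KB → Decides KB φ₀ ψ)
    (h_occ : Form.OnlyAllowed θ ξ KB)
    (h_const : (Sum.inl ⟨0, c⟩ : L.Symbols) ∉ θ.symbols ∪ ξ.symbols)
    (h_base : Disjoint φ₀.symbols (θ.symbols ∪ ξ.symbols)) {τ : Tolerance}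
    (h_prop : EntailsMem KB τ (.cond 1 (θ.atVar 0) (φ₀.atVar 0)) a b) {N : ℕ} (hN : 0 < N)
    (h_pos : 0 < numWorlds N τ KB) : prob N τ (θ.atConst c) KB ∈ Set.Icc a b := by
  classical
  have : Fintype (World L N) := Fintype.ofFinite _
  have hcA : ∀ W : World L N, Models W τ KB → φ₀.Holds W τ (denotation W c) := fun W hW =>
    (@Form.realize_atConst L _ W τ φ₀ c _).1 (h_c N hN W τ hW Fin.elim0)
  have hA : ∀ (W : World L N) (d : Fin N), φ₀.Holds (exchange (θ.symbols ∪ ξ.symbols) c W d) τ =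
      φ₀.Holds W τ := by
    intro W d
    funext x
    exact propext ((isoOn_compl_twist _ _ W).holds_iff τ φ₀
      (Set.subset_compl_iff_disjoint_right.2 h_base) x).symm
  have hmodels : ∀ W : World L N, Models W τ KB → ∀ d, φ₀.Holds W τ d →
      Models (exchange (θ.symbols ∪ ξ.symbols) c W d) τ KB := by
    intro W hW d hd
    -- The transposition moves only the denotation of `c` and `d`, both of which lie in `φ₀`.
    have he : ∀ x, Equiv.swap (denotation W c) d x = x ∨
        φ₀.Holds W τ x ∧ φ₀.Holds W τ (Equiv.swap (denotation W c) d x) := by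
      intro x
      by_cases h1 : x = denotation W c
      · subst h1
        exact Or.inr ⟨hcA W hW, by rwa [Equiv.swap_apply_left]⟩
      by_cases h2 : x = d
      · subst h2
        exact Or.inr ⟨hd, by rw [Equiv.swap_apply_right]; exact hcA W hW⟩
      exact Or.inl (Equiv.swap_apply_of_ne_of_ne h1 h2)
    exact (h_occ.realize_twist W τ _ (fun m φ o => (h_theta m φ o).invariant hN hW he)
      (fun m ψ o => (h_xi m ψ o).invariant hN hW he) _).1 hW
  have hcard : ∀ χ : Form L 0, numWorlds N τ χ =
      (Finset.univ.filter fun W : World L N => Models W τ χ).card := by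
    intro χ
    rw [numWorlds, ← Set.ncard_coe_finset]
    simp
  have hand : (Finset.univ.filter fun W : World L N => Models W τ ((θ.atConst c).and KB)) =
      (Finset.univ.filter fun W : World L N => Models W τ KB).filter
        fun W => θ.Holds W τ (denotation W c) := by
    ext W
    simp only [Finset.mem_filter, Finset.mem_univ, true_and]
    simp only [Models, Form.Realize]
    rw [@Form.realize_atConst L _ W]
    exact and_comm
  rw [hcard, Finset.card_pos] at h_pos
  rw [prob, hcard, hcard, hand]
  refine div_mem_Icc_of_exchange _ h_pos (fun W => φ₀.Holds W τ) (fun W => θ.Holds W τ)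
    (fun W => denotation W c) (exchange (θ.symbols ∪ ξ.symbols) c) ?_ ?_ ?_ ?_ ?_ ?_
  all_goals
    intro W hW
    simp only [Finset.mem_filter, Finset.mem_univ, true_and] at hW
  · exact hcA W hW
  · intro d hd
    simpa using hmodels W hW d hd
  · exact fun d _ => hA W d
  · exact fun d _ => exchange_exchange h_const W d
  · intro d _
    rw [(isoOn_twist _ (Equiv.swap (denotation W c) d) W).holds_iff τ θ Set.subset_union_left,
      Equiv.swap_apply_left]
  -- The denotation of `c` witnesses that the proportion is defined, so the assumed bound applies to
  -- its value.
  · have := h_prop N hN W hW _ (@hasValue_cond_atVar L _ W τ θ φ₀ _ _ (hcA W hW))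
    simpa [← Set.ncard_coe_finset] using this

end Count

end RandomWorlds

-- Passage to the limits.

theorem mainTheorem3 {L : FirstOrder.Language.{u, v}} [Finite L.Symbols]
    (KB : RandomWorlds.Form L 0) (c : L.Constants) (φ₀ θ ξ : RandomWorlds.Form L 1) (a b : ℝ)
    (h_c : RandomWorlds.Entails KB (φ₀.atConst c))
    (h_link : RandomWorlds.Entails KB (RandomWorlds.Form.link ξ θ 0))
    (h_theta : ∀ (n : ℕ) (φ : RandomWorlds.Form L (n + 1)),
      RandomWorlds.Form.Occurs (θ.atVar n) φ KB → RandomWorlds.Decides KB φ₀ φ)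
    (h_xi : ∀ (n : ℕ) (ψ : RandomWorlds.Form L (n + 1)),
      RandomWorlds.Form.Occurs (ξ.atVar n) ((θ.atVar n).and ψ) KB → RandomWorlds.Decides KB φ₀ ψ)
    (h_occ : RandomWorlds.Form.OnlyAllowed θ ξ KB)
    (h_const : (Sum.inl ⟨0, c⟩ : L.Symbols) ∉ θ.symbols ∪ ξ.symbols)
    (h_base : Disjoint φ₀.symbols (θ.symbols ∪ ξ.symbols))
    (h_prop : ∀ᶠ τ : RandomWorlds.Tolerance in Filter.atBot,
      RandomWorlds.EntailsMem KB τ (.cond 1 (θ.atVar 0) (φ₀.atVar 0)) a b)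
    (p : ℝ) (h_bel : RandomWorlds.IsDegreeOfBelief (θ.atConst c) KB p) :
    p ∈ Set.Icc a b := by
  obtain ⟨h_cons, h_inf, -⟩ := h_bel
  -- The limit of the lower probabilities alone determines `p`, and the interval is closed.
  refine isClosed_Icc.mem_of_tendsto h_inf ?_
  filter_upwards [h_prop, h_cons] with τ hτ hcons
  have hmem : ∀ᶠ N : ℕ in Filter.atTop,
      RandomWorlds.prob N τ (θ.atConst c) KB ∈ Set.Icc a b := by
    filter_upwards [hcons, Filter.eventually_gt_atTop 0] with N hN h0
    exact RandomWorlds.prob_mem_Icc KB c φ₀ θ ξ h_c h_theta h_xi h_occ h_const h_base hτ h0 hN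
  have hle := hmem.mono fun _ h => h.1
  have hge := hmem.mono fun _ h => h.2
  -- Over `ℝ`, `liminf` and `limsup` take default values on unbounded families; the eventual bounds
  -- `a` and `b` rule this out.
  have hbdd : Filter.IsBoundedUnder (· ≤ ·) Filter.atTop
      (fun N => RandomWorlds.prob N τ (θ.atConst c) KB) := ⟨b, hge⟩
  have hbdd' : Filter.IsBoundedUnder (· ≥ ·) Filter.atTop
      (fun N => RandomWorlds.prob N τ (θ.atConst c) KB) := ⟨a, hle⟩
  exact ⟨Filter.le_liminf_of_le hbdd.isCoboundedUnder_ge hle,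
    (Filter.liminf_le_limsup hbdd hbdd').trans
      (Filter.limsup_le_of_le hbdd'.isCoboundedUnder_le hge)⟩
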